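/- Let $\Omega=\{x\in\mathbb R^2: |x-(1,0)|<1\}$ be the open unit disk centred at $(1,0)$, so that the origin lies on $\partial\Omega$. Let $\alpha\in(0,1)$ and $A>1$, and put $\beta=\frac{A-1}{A-\alpha}\in(0,1)$. For $\varepsilon\in(0,1)$ let $d_\varepsilon=\varepsilon^\beta$, $a_\varepsilon=(d_\varepsilon,0)$, and $$f_\varepsilon(x)=\begin{cases}4A/\varepsilon^2,&|x-a_\varepsilon|<\varepsilon,\\0,&\text{otherwise.}\end{cases}$$ Then for every $\varepsilon\in(0,1)$ there is a function $u_\varepsilon$, of class $C^1$ on $\overline\Omega$, which is a weak solution of the Dirichlet problem $$-\Delta u_\varepsilon=f_\varepsilon\ \text{ in }\Omega,\qquad u_\varepsilon=0\ \text{ on }\partial\Omega,$$ and which therefore, with $V_\varepsilon=|x|^{2\alpha}f_\varepsilon e^{-u_\varepsilon}$, is also a weak solution of $$-\Delta u_\varepsilon=V_\varepsilon\frac{e^{u_\varepsilon}}{|x|^{2\alpha}}\ \text{ in }\Omega,\qquad u_\varepsilon=0\ \text{ on }\partial\Omega.$$ (A weak solution of $-\Delta u=g$ satisfies $\int_\Omega\nabla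 u\cdot\nabla\varphi\,dx=\int_\Omega g\varphi\,dx$ for all $\varphi\in C_c^\infty(\Omega)$, where $g\in L^1_{\rm loc}(\Omega)$.) Moreover, there is a constant $C$, independent of $\varepsilon$, such that for all $\varepsilon\in(0,1)$ $$0\le V_\varepsilon\le C\ \text{ in }\Omega,\qquad \int_\Omega\frac{e^{u_\varepsilon}}{|x|^{2\alpha}}\,dx\le C,$$ while $\sup_\Omega u_\varepsilon\to+\infty$ as $\varepsilon\to0^+$. -/

import Mathlib

open MeasureTheory Set Filter Topology
open scoped ContDiff

/-- The Euclidean plane. -/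
abbrev Plane : Type := EuclideanSpace ℝ (Fin 2)

/-- The open unit disk centred at `(1, 0)`; the origin lies on its boundary. -/
def unitDisk : Set Plane := Metric.ball !₂[(1 : ℝ), 0] 1

/-- `u` is a solution of `-Δ u = g` in the open set `Ω`, `u = 0` on `∂Ω`:
`u` is of class `C¹` up to the boundary, vanishes on the boundary, and satisfies the equation
in the weak sense against all smooth test functions with compact support in `Ω`.
(Local integrability of `g` makes the right-hand integral meaningful.) -/
structure IsDirichletSolution (Ω : Set Plane) (g u : Plane → ℝ) : Prop where
  contDiffOn_closure : ContDiffOn ℝ 1 u (closure Ω)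
  eq_zero_on_boundary : ∀ x ∈ frontier Ω, u x = 0
  locallyIntegrableOn_rhs : LocallyIntegrableOn g Ω
  weak_eq : ∀ φ : Plane → ℝ, ContDiff ℝ ∞ φ → HasCompactSupport φ → tsupport φ ⊆ Ω →
    ∫ x in Ω, inner ℝ (gradient u x) (gradient φ x) = ∫ x in Ω, g x * φ x

/-- The distance `d_ε = ε ^ β`, `β = (A - 1) / (A - α)`. -/
noncomputable def concDist (α A ε : ℝ) : ℝ := ε ^ ((A - 1) / (A - α))

/-- The concentration point `a_ε = (d_ε, 0)`. -/
noncomputable def concPoint (α A ε : ℝ) : Plane := !₂[concDist α A ε, 0]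

/-- The Brezis–Merle right-hand side `f_ε`: equal to `4 A / ε²` on the disk `B_ε(a_ε)` and to `0`
elsewhere (its total mass is `4 π A`). -/
noncomputable def brezisMerleRhs (α A ε : ℝ) : Plane → ℝ :=
  (Metric.ball (concPoint α A ε) ε).indicator (fun _ => 4 * A / ε ^ 2)

/-! The solution is explicit. Write `d` for `d_ε` and `a` for `a_ε`. Outside `B_ε(a)` it is the
Green potential of a point mass `4πA` at `a`, obtained by reflecting `a` to `-d/(1-d)`; inside, `log
‖x - a‖²` is replaced by its tangent in `‖x - a‖²`, whose Laplacian is the constant `4/ε²`. On the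
closed disk `u = A (log ‖(1-d)x + a‖² - P)`, with `P` this capped logarithm.

All estimates come from this formula. On `B_ε(a)`, `‖x‖ ≤ 2d` and `e^{-u} ≤ (ε/d)^{2A}`, so `V` is
at most a constant times `ε^{2A-2} d^{-2(A-α)}` (`weight_le`). For `‖x - a‖ ≥ d/2`, `e^u` is bounded
and `‖x‖^{-2α}` is integrable; nearer to `a`, `‖x‖ ≥ d/2` and `e^u ≲ d^{2A} (‖x - a‖² + ε²)^{-A}`,
which contributes `d^{2(A-α)} ε^{2-2A}` (`exp_diskPotential_div_le`). The exponent `β` is the one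
making both powers equal to `1`. Since `β < 1`, `d/ε → ∞`, hence `u(a) ≥ 2A log (d/ε) → ∞`. -/

/-- A `C¹` regularisation of the logarithm: it equals `log t` for `s ≤ t` and is affine
for `t ≤ s`. -/
noncomputable def cappedLog (s t : ℝ) : ℝ := Real.log (max t s) + min (t / s) 1 - 1

lemma cappedLog_of_le {s t : ℝ} (hs : 0 < s) (h : s ≤ t) : cappedLog s t = Real.log t := by
  have : 1 ≤ t / s := by rwa [le_div_iff₀ hs, one_mul]
  simp [cappedLog, max_eq_left h, min_eq_right this]

lemma cappedLog_of_ge {s t : ℝ} (hs : 0 < s) (h : t ≤ s) :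
    cappedLog s t = Real.log s + t / s - 1 := by
  have : t / s ≤ 1 := by rwa [div_le_iff₀ hs, one_mul]
  simp [cappedLog, max_eq_right h, min_eq_left this]

/-- The affine branch is the tangent to `log` at `s`, so the one-sided derivatives agree there. -/
lemma hasDerivAt_cappedLog {s : ℝ} (hs : 0 < s) (t : ℝ) :
    HasDerivAt (cappedLog s) (max t s)⁻¹ t := by
  have hlow (t : ℝ) : HasDerivAt (fun t => Real.log s + t / s - 1) s⁻¹ t := by
    simpa using (((hasDerivAt_id t).div_const s).const_add (Real.log s)).sub_const 1
  rcases lt_trichotomy t s with h | rfl | h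
  · rw [max_eq_right h.le]
    refine (hlow t).congr_of_eventuallyEq ?_
    filter_upwards [Iio_mem_nhds h] with y hy using cappedLog_of_ge hs (le_of_lt hy)
  · rw [max_self, ← hasDerivWithinAt_univ, ← Iic_union_Ici (a := t)]
    exact ((hlow t).hasDerivWithinAt.congr (fun y hy => cappedLog_of_ge hs hy)
        (cappedLog_of_ge hs le_rfl)).union
      ((Real.hasDerivAt_log hs.ne').hasDerivWithinAt.congr (fun y hy => cappedLog_of_le hs hy)
        (cappedLog_of_le hs le_rfl))
  · rw [max_eq_left h.le]
    refine (Real.hasDerivAt_log (hs.trans h).ne').congr_of_eventuallyEq ?_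
    filter_upwards [Ioi_mem_nhds h] with y hy using cappedLog_of_le hs (le_of_lt hy)

lemma contDiff_cappedLog {s : ℝ} (hs : 0 < s) : ContDiff ℝ 1 (cappedLog s) := by
  rw [contDiff_one_iff_deriv]
  refine ⟨fun t => (hasDerivAt_cappedLog hs t).differentiableAt, ?_⟩
  rw [show deriv (cappedLog s) = fun t => (max t s)⁻¹ from
    funext fun t => (hasDerivAt_cappedLog hs t).deriv]
  exact (continuous_id.max continuous_const).inv₀ fun t => (lt_max_of_lt_right hs).ne'

/-! ### Logarithmic potential of a ball and its gradient field -/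

section Potential

variable {E : Type*} [NormedAddCommGroup E] [InnerProductSpace ℝ E]

/-- The logarithmic potential of the ball of centre `c` and radius `δ`, normalised to be equal to
`log ‖x - c‖²` outside of the ball. -/
noncomputable def ballPotential (c : E) (δ : ℝ) (x : E) : ℝ := cappedLog (δ ^ 2) (‖x - c‖ ^ 2)

/-- The gradient of `ballPotential`. -/
noncomputable def ballField (c : E) (δ : ℝ) (x : E) : E :=
  (2 / max (‖x - c‖ ^ 2) (δ ^ 2)) • (x - c)

lemma contDiff_ballPotential (c : E) {δ : ℝ} (hδ : 0 < δ) :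
    ContDiff ℝ 1 (ballPotential c δ) :=
  (contDiff_cappedLog (pow_pos hδ 2)).comp ((contDiff_id.sub contDiff_const).norm_sq ℝ)

lemma hasGradientAt_ballPotential [CompleteSpace E] (c : E) {δ : ℝ} (hδ : 0 < δ) (x : E) :
    HasGradientAt (ballPotential c δ) (ballField c δ x) x := by
  rw [hasGradientAt_iff_hasFDerivAt]
  have h := (hasDerivAt_cappedLog (pow_pos hδ 2) (‖x - c‖ ^ 2)).comp_hasFDerivAt x
    ((hasFDerivAt_id x).sub_const c).norm_sq
  refine h.congr_fderiv ?_
  ext v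
  simp [ballField]
  ring

/-- Lipschitz regularity allows integration by parts across the sphere, where the field has a kink.
With `m = max ‖x - c‖ δ` the field is `2 m⁻² (x - c)`, and `m` is 1-Lipschitz and at least `δ`;
varying `x - c` costs `2/δ²`, varying `m⁻²` costs `4/δ²`. -/
lemma lipschitzWith_ballField (c : E) {δ : ℝ} (hδ : 0 < δ) :
    LipschitzWith (6 / δ ^ 2).toNNReal (ballField c δ) := by
  refine LipschitzWith.of_dist_le' fun x y => ?_
  set m : E → ℝ := fun z => max ‖z - c‖ δ with hm
  have hmδ (z) : δ ≤ m z := le_max_right _ _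
  have hmp (z) : 0 < m z := hδ.trans_le (hmδ z)
  have hmn (z) : ‖z - c‖ ≤ m z := le_max_left _ _
  have hF (z) : ballField c δ z = (2 / m z ^ 2) • (z - c) := by
    have : max (‖z - c‖ ^ 2) (δ ^ 2) = m z ^ 2 := by
      rcases le_total ‖z - c‖ δ with h | h
      · simp [hm, max_eq_right h, max_eq_right (pow_le_pow_left₀ (norm_nonneg _) h 2)]
      · simp [hm, max_eq_left h, max_eq_left (pow_le_pow_left₀ hδ.le h 2)]
    rw [ballField, this]
  have hmL : |m y - m x| ≤ dist x y := by
    refine (abs_max_sub_max_le_abs _ _ _).trans ?_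
    refine (abs_norm_sub_norm_le _ _).trans ?_
    rw [dist_comm, dist_eq_norm]
    simp
  have hsplit : ballField c δ x - ballField c δ y =
      (2 / m x ^ 2) • (x - y) + (2 / m x ^ 2 - 2 / m y ^ 2) • (y - c) := by
    rw [hF, hF]; module
  have hcoef : |2 / m x ^ 2 - 2 / m y ^ 2| * m y ≤ 4 / δ ^ 2 * dist x y := by
    have h1 : 2 / m x ^ 2 - 2 / m y ^ 2 =
        (2 / (m x ^ 2 * m y) + 2 / (m x * m y ^ 2)) * (m y - m x) := by
      have := (hmp x).ne'
      have := (hmp y).ne'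
      field_simp
      ring
    have h2 : 0 ≤ 2 / (m x ^ 2 * m y) + 2 / (m x * m y ^ 2) := by
      have := hmp x
      have := hmp y
      positivity
    have h3 : (2 / (m x ^ 2 * m y) + 2 / (m x * m y ^ 2)) * m y =
        2 / (m x * m x) + 2 / (m x * m y) := by
      have := (hmp x).ne'
      have := (hmp y).ne'
      field_simp
    have h4 : 2 / (m x * m x) + 2 / (m x * m y) ≤ 4 / δ ^ 2 := by
      have e : (4 : ℝ) / δ ^ 2 = 2 / (δ * δ) + 2 / (δ * δ) := by rw [← add_div, sq]; norm_num
      rw [e]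
      have hx := hmδ x
      have hy := hmδ y
      gcongr
    rw [h1, abs_mul, abs_of_nonneg h2, mul_right_comm, h3]
    exact mul_le_mul h4 hmL (abs_nonneg _) (by positivity)
  rw [dist_eq_norm, hsplit]
  refine (norm_add_le _ _).trans ?_
  rw [norm_smul, norm_smul, Real.norm_eq_abs, Real.norm_eq_abs, ← dist_eq_norm]
  have h5 : |2 / m x ^ 2| ≤ 2 / δ ^ 2 := by
    rw [abs_of_pos (by have := hmp x; positivity)]
    have hx := hmδ x
    gcongr
  calc _ ≤ 2 / δ ^ 2 * dist x y + |2 / m x ^ 2 - 2 / m y ^ 2| * m y := by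
        gcongr
        exact hmn y
    _ ≤ 2 / δ ^ 2 * dist x y + 4 / δ ^ 2 * dist x y := by gcongr
    _ = 6 / δ ^ 2 * dist x y := by ring

end Potential

/-! ### Distributional divergence of the field in the plane -/

lemma lipschitzWith_ballField_apply (c : Plane) {δ : ℝ} (hδ : 0 < δ) (i : Fin 2) :
    LipschitzWith (6 / δ ^ 2).toNNReal (fun x => ballField c δ x i) := by
  have h : LipschitzWith 1 (fun x : Plane => x i) := LipschitzWith.of_dist_le_mul fun x y => by
    simpa [dist_eq_norm] using PiLp.norm_apply_le (x - y) i
  rw [← one_mul (Real.toNNReal _)]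
  exact h.comp (lipschitzWith_ballField c hδ)

/-- Inside, the field is `(2/δ²)(x - c)`; outside it is the gradient of `log ‖x - c‖²`, harmonic in
dimension two. The excluded circle is a null set. -/
lemma sum_lineDeriv_ballField (c : Plane) {δ : ℝ} (hδ : 0 < δ) {x : Plane}
    (hx : x ∉ Metric.sphere c δ) :
    ∑ i, lineDeriv ℝ (fun x => ballField c δ x i) x (EuclideanSpace.single i 1) =
      (Metric.ball c δ).indicator (fun _ => 4 / δ ^ 2) x := by
  have hcoord (i : Fin 2) : HasFDerivAt (fun y : Plane => y i - c i)
      (EuclideanSpace.proj i : Plane →L[ℝ] ℝ) x :=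
    (EuclideanSpace.proj i : Plane →L[ℝ] ℝ).hasFDerivAt.sub_const _
  rw [mem_sphere_iff_norm] at hx
  rcases lt_or_gt_of_ne hx with h | h
  · have hev : ∀ᶠ y in 𝓝 x, ‖y - c‖ < δ :=
      (continuous_id.sub continuous_const).norm.continuousAt.eventually_lt
        continuousAt_const h
    have hd (i : Fin 2) : lineDeriv ℝ (fun x => ballField c δ x i) x (EuclideanSpace.single i 1) =
        2 / δ ^ 2 := by
      have h1 := (hcoord i).const_mul (2 / δ ^ 2)
      have h2 : HasFDerivAt (fun x => ballField c δ x i) _ x := h1.congr_of_eventuallyEq (by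
        filter_upwards [hev] with y hy
        simp [ballField, max_eq_right (pow_le_pow_left₀ (norm_nonneg _) hy.le 2)])
      rw [(h2.hasLineDerivAt _).lineDeriv]
      simp
    rw [indicator_of_mem (mem_ball_iff_norm.mpr h), Fin.sum_univ_two, hd, hd]
    ring
  · have hev : ∀ᶠ y in 𝓝 x, δ < ‖y - c‖ :=
      continuousAt_const.eventually_lt
        (continuous_id.sub continuous_const).norm.continuousAt h
    have hpos : 0 < ‖x - c‖ := hδ.trans h
    have hd (i : Fin 2) : lineDeriv ℝ (fun x => ballField c δ x i) x (EuclideanSpace.single i 1) =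
        2 / ‖x - c‖ ^ 2 - 4 * (x i - c i) ^ 2 / (‖x - c‖ ^ 2) ^ 2 := by
      have hn := ((hasFDerivAt_id (𝕜 := ℝ) x).sub_const c).norm_sq
      have h0 := ((hasDerivAt_inv (pow_pos hpos 2).ne').comp_hasFDerivAt x hn)
      have h1 := ((h0.mul (hcoord i)).const_mul 2)
      have h2 : HasFDerivAt (fun x => ballField c δ x i) _ x := h1.congr_of_eventuallyEq (by
        filter_upwards [hev] with y hy
        simp [ballField, max_eq_left (pow_le_pow_left₀ hδ.le hy.le 2)]
        ring)
      rw [(h2.hasLineDerivAt _).lineDeriv]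
      simp [EuclideanSpace.inner_single_right]
      ring
    rw [indicator_of_notMem (fun hb => h.not_gt (mem_ball_iff_norm.mp hb)), Fin.sum_univ_two, hd, hd]
    have hs : ‖x - c‖ ^ 2 = (x 0 - c 0) ^ 2 + (x 1 - c 1) ^ 2 := by
      simp [EuclideanSpace.norm_sq_eq]
    have hne := (pow_pos hpos 2).ne'
    field_simp
    rw [hs]
    ring

lemma integral_inner_ballField_gradient (c : Plane) {δ : ℝ} (hδ : 0 < δ) {φ : Plane → ℝ}
    (hφ : ContDiff ℝ ∞ φ) (hc : HasCompactSupport φ) :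
    Integrable (fun x => inner ℝ (ballField c δ x) (gradient φ x)) ∧
    ∫ x, inner ℝ (ballField c δ x) (gradient φ x) =
      -∫ x, (Metric.ball c δ).indicator (fun _ => 4 / δ ^ 2) x * φ x := by
  have hφ1 : ContDiff ℝ 1 φ := hφ.of_le (by simp)
  obtain ⟨D, hD⟩ := hφ1.lipschitzWith_of_hasCompactSupport hc one_ne_zero
  have hF := lipschitzWith_ballField_apply c hδ
  set e : Fin 2 → Plane := fun i => EuclideanSpace.single i 1 with he
  have hgrad (x : Plane) (i : Fin 2) : gradient φ x i = fderiv ℝ φ x (e i) := by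
    have : inner ℝ (gradient φ x) (e i) = fderiv ℝ φ x (e i) := by simp [gradient]
    rw [← this, real_inner_comm]
    simp only [he, EuclideanSpace.inner_single_left]
    simp
  have hline (x : Plane) (v : Plane) : lineDeriv ℝ φ x v = fderiv ℝ φ x v :=
    (hφ1.differentiable one_ne_zero x).lineDeriv_eq_fderiv
  have hinner (x : Plane) : inner ℝ (ballField c δ x) (gradient φ x) =
      ∑ i, fderiv ℝ φ x (e i) * ballField c δ x i := by
    rw [PiLp.inner_apply]
    exact Finset.sum_congr rfl fun i _ => by rw [← hgrad]; rfl
  have hibp (i : Fin 2) : ∫ x, lineDeriv ℝ (fun x => ballField c δ x i) x (e i) * φ x =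
      -∫ x, fderiv ℝ φ x (e i) * ballField c δ x i := by
    rw [(hF i).integral_lineDeriv_mul_eq hD hc, ← integral_neg]
    simp [hline]
  have hint1 (i : Fin 2) : Integrable fun x => fderiv ℝ φ x (e i) * ballField c δ x i := by
    refine Continuous.integrable_of_hasCompactSupport ?_ ?_
    · exact ((hφ1.continuous_fderiv one_ne_zero).clm_apply continuous_const).mul (hF i).continuous
    · exact (hc.fderiv_apply ℝ (e i)).mul_right
  have hint2 (i : Fin 2) :
      Integrable fun x => lineDeriv ℝ (fun x => ballField c δ x i) x (e i) * φ x := by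
    have h1 : Integrable φ := hφ.continuous.integrable_of_hasCompactSupport hc
    have h2 := (hF i).memLp_lineDeriv (μ := volume) (e i)
    exact h1.smul_of_top_right h2 
  refine ⟨by simp_rw [hinner]; exact integrable_finsetSum _ fun i _ => hint1 i, ?_⟩
  simp_rw [hinner]
  have hdiv : ∫ x, (Metric.ball c δ).indicator (fun _ => 4 / δ ^ 2) x * φ x =
      ∑ i, ∫ x, lineDeriv ℝ (fun x => ballField c δ x i) x (e i) * φ x := by
    rw [← integral_finsetSum _ fun i _ => hint2 i]
    refine integral_congr_ae ?_
    filter_upwards [compl_mem_ae_iff.mpr (Measure.addHaar_sphere volume c δ)] with x hx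
    rw [← Finset.sum_mul, sum_lineDeriv_ballField c hδ hx]
  rw [hdiv, integral_finsetSum _ fun i _ => hint1 i]
  simp [hibp]

/-! ### Method of images in the disk -/

lemma mem_unitDisk_iff {x : Plane} : x ∈ unitDisk ↔ (x 0 - 1) ^ 2 + x 1 ^ 2 < 1 := by
  rw [unitDisk, mem_ball_iff_norm, ← sq_lt_one_iff₀ (norm_nonneg _), EuclideanSpace.norm_sq_eq]
  simp

lemma mem_closure_unitDisk_iff {x : Plane} :
    x ∈ closure unitDisk ↔ (x 0 - 1) ^ 2 + x 1 ^ 2 ≤ 1 := by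
  rw [unitDisk, closure_ball _ one_ne_zero, mem_closedBall_iff_norm,
    ← sq_le_one_iff₀ (norm_nonneg _), EuclideanSpace.norm_sq_eq]
  simp

lemma mem_frontier_unitDisk_iff {x : Plane} :
    x ∈ frontier unitDisk ↔ (x 0 - 1) ^ 2 + x 1 ^ 2 = 1 := by
  rw [unitDisk, frontier_ball _ one_ne_zero, mem_sphere_iff_norm,
    ← sq_eq_sq₀ (norm_nonneg _) zero_le_one, EuclideanSpace.norm_sq_eq]
  simp

/-- The image, up to the factor `-d / (1 - d)`, of the point `(d, 0)` under the inversion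
in the unit circle centred at `(1, 0)`. -/
noncomputable def mirrorPoint (d : ℝ) : Plane := !₂[-(d / (1 - d)), 0]

/-- The solution of `-Δ u = (4 A / ε²) 1_{B_ε(d, 0)}` in the unit disk centred at `(1, 0)`, with zero
boundary values, obtained by the method of images. -/
noncomputable def diskPotential (A d ε : ℝ) (x : Plane) : ℝ :=
  A * (ballPotential (mirrorPoint d) (d / (1 - d)) x + Real.log ((1 - d) ^ 2) -
    ballPotential !₂[d, 0] ε x)

lemma norm_sub_center_sq (d : ℝ) (x : Plane) :
    ‖x - !₂[d, 0]‖ ^ 2 = (x 0 - d) ^ 2 + x 1 ^ 2 := by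
  rw [EuclideanSpace.norm_sq_eq]
  simp

lemma norm_sub_mirrorPoint_sq (d : ℝ) (x : Plane) :
    ‖x - mirrorPoint d‖ ^ 2 = (x 0 + d / (1 - d)) ^ 2 + x 1 ^ 2 := by
  rw [EuclideanSpace.norm_sq_eq]
  simp [mirrorPoint]

/-- The capped ball around the image point lies in `x 0 < 0` and touches the closed disk at most at
the origin. Hence capping makes the image term `C¹` on the whole plane without changing it on the
closed disk or adding mass in the disk. -/
lemma sq_le_norm_sub_mirrorPoint_sq {d : ℝ} (hd : 0 < d) (hd1 : d < 1) {x : Plane}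
    (hx : x ∈ closure unitDisk) : (d / (1 - d)) ^ 2 ≤ ‖x - mirrorPoint d‖ ^ 2 := by
  rw [mem_closure_unitDisk_iff] at hx
  rw [norm_sub_mirrorPoint_sq]
  have h0 : 0 ≤ x 0 := by nlinarith [sq_nonneg (x 0), sq_nonneg (x 1)]
  have h1 : 0 < d / (1 - d) := div_pos hd (by linarith)
  nlinarith [sq_nonneg (x 0), sq_nonneg (x 1), mul_nonneg h0 h1.le]

lemma diskPotential_eq (A : ℝ) {d : ℝ} (hd : 0 < d) (hd1 : d < 1) (ε : ℝ) {x : Plane}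
    (hx : x ∈ closure unitDisk) :
    diskPotential A d ε x = A * (Real.log (((1 - d) * x 0 + d) ^ 2 + ((1 - d) * x 1) ^ 2) -
      ballPotential !₂[d, 0] ε x) := by
  have h1 : 0 < d / (1 - d) := div_pos hd (by linarith)
  have h2 := sq_le_norm_sub_mirrorPoint_sq hd hd1 hx
  have h3 : (1 - d) ≠ 0 := by linarith
  rw [diskPotential, ballPotential, cappedLog_of_le (pow_pos h1 2) h2,
    ← Real.log_mul ((pow_pos h1 2).trans_le h2).ne' (pow_ne_zero 2 h3), norm_sub_mirrorPoint_sq]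
  congr 4
  field_simp

lemma contDiff_diskPotential (A : ℝ) {d ε : ℝ} (hd : 0 < d) (hd1 : d < 1) (hε : 0 < ε) :
    ContDiff ℝ 1 (diskPotential A d ε) :=
  contDiff_const.mul (((contDiff_ballPotential _ (div_pos hd (by linarith))).add
    contDiff_const).sub (contDiff_ballPotential _ hε))

lemma gradient_diskPotential (A : ℝ) {d ε : ℝ} (hd : 0 < d) (hd1 : d < 1) (hε : 0 < ε)
    (x : Plane) : gradient (diskPotential A d ε) x =
      A • (ballField (mirrorPoint d) (d / (1 - d)) x - ballField !₂[d, 0] ε x) := by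
  refine HasGradientAt.gradient ?_
  have h1 := (hasGradientAt_ballPotential (mirrorPoint d) (div_pos hd (sub_pos.mpr hd1)) x)
  have h2 := hasGradientAt_ballPotential !₂[d, 0] hε x
  rw [hasGradientAt_iff_hasFDerivAt] at h1 h2 ⊢
  refine (((h1.add_const (Real.log ((1 - d) ^ 2))).sub h2).const_mul A).congr_fderiv ?_
  simp

lemma ball_subset_unitDisk {d ε : ℝ} (hd1 : d < 1) (hεd : ε ≤ d) :
    Metric.ball !₂[d, 0] ε ⊆ unitDisk := by
  refine Metric.ball_subset_ball' ?_
  have : dist (!₂[d, 0] : Plane) !₂[1, 0] = 1 - d := by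
    rw [EuclideanSpace.dist_eq]
    simp [Real.dist_eq, Real.sqrt_sq_eq_abs, abs_of_neg (sub_neg.mpr hd1)]
  linarith

lemma diskPotential_eq_zero (A : ℝ) {d ε : ℝ} (hd : 0 < d) (hd1 : d < 1) (hε : 0 < ε)
    (hεd : ε ≤ d) {x : Plane} (hx : x ∈ frontier unitDisk) : diskPotential A d ε x = 0 := by
  have hx2 := mem_frontier_unitDisk_iff.mp hx
  have hball : x ∉ Metric.ball !₂[d, 0] ε := fun h =>
    (mem_unitDisk_iff.mp (ball_subset_unitDisk hd1 hεd h)).ne hx2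
  have hr : ε ^ 2 ≤ ‖x - !₂[d, 0]‖ ^ 2 := by
    rw [mem_ball_iff_norm, not_lt] at hball
    exact pow_le_pow_left₀ hε.le hball 2
  rw [diskPotential_eq A hd hd1 ε (frontier_subset_closure hx), ballPotential,
    cappedLog_of_le (pow_pos hε 2) hr, norm_sub_center_sq]
  -- The two sides differ by `(d² - 2d)((x 0 - 1)² + (x 1)² - 1)`, which vanishes on the unit
  -- circle.
  have : ((1 - d) * x 0 + d) ^ 2 + ((1 - d) * x 1) ^ 2 = (x 0 - d) ^ 2 + x 1 ^ 2 := by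
    linear_combination (d ^ 2 - 2 * d) * hx2
  rw [this, sub_self, mul_zero]

lemma weak_eq_diskPotential (A : ℝ) {d ε : ℝ} (hd : 0 < d) (hd1 : d < 1) (hε : 0 < ε)
    {φ : Plane → ℝ} (hφ : ContDiff ℝ ∞ φ) (hc : HasCompactSupport φ)
    (hs : tsupport φ ⊆ unitDisk) :
    ∫ x in unitDisk, inner ℝ (gradient (diskPotential A d ε) x) (gradient φ x) =
      ∫ x in unitDisk, (Metric.ball !₂[d, 0] ε).indicator (fun _ => 4 * A / ε ^ 2) x * φ x := by
  have hδ : 0 < d / (1 - d) := div_pos hd (sub_pos.mpr hd1)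
  have hφ0 (x) (hx : x ∉ unitDisk) : φ x = 0 :=
    image_eq_zero_of_notMem_tsupport fun h => hx (hs h)
  have hg0 (x) (hx : x ∉ unitDisk) : gradient φ x = 0 := by
    have : fderiv ℝ φ x = 0 := image_eq_zero_of_notMem_tsupport
      fun h => hx (hs (tsupport_fderiv_subset ℝ h))
    simp [gradient, this]
  rw [setIntegral_eq_integral_of_forall_compl_eq_zero fun x hx => by rw [hg0 x hx, inner_zero_right],
    setIntegral_eq_integral_of_forall_compl_eq_zero fun x hx => by rw [hφ0 x hx, mul_zero]]
  obtain ⟨i1, e1⟩ := integral_inner_ballField_gradient (mirrorPoint d) hδ hφ hc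
  obtain ⟨i2, e2⟩ := integral_inner_ballField_gradient !₂[d, 0] hε hφ hc
  -- The mass of the image term lies outside the disk, where `φ` vanishes.
  have hz (x) : (Metric.ball (mirrorPoint d) (d / (1 - d))).indicator
      (fun _ => 4 / (d / (1 - d)) ^ 2) x * φ x = 0 := by
    by_cases hx : x ∈ unitDisk
    · have h := sq_le_norm_sub_mirrorPoint_sq hd hd1 (subset_closure hx)
      rw [indicator_of_notMem, zero_mul]
      rw [mem_ball_iff_norm, not_lt]
      exact le_of_sq_le_sq h (norm_nonneg _)
    · rw [hφ0 x hx, mul_zero]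
  simp_rw [gradient_diskPotential A hd hd1 hε, inner_smul_left, inner_sub_left]
  rw [integral_const_mul, integral_sub i1 i2, e1, e2]
  simp_rw [hz]
  rw [integral_zero, neg_zero, zero_sub, neg_neg]
  simp only [conj_trivial]
  rw [← integral_const_mul]
  refine integral_congr_ae (.of_forall fun x => ?_)
  by_cases hx : x ∈ Metric.ball !₂[d, 0] ε
  · simp only [indicator_of_mem hx]
    ring
  · simp only [indicator_of_notMem hx]
    ring

lemma isDirichletSolution_diskPotential (A : ℝ) {d ε : ℝ} (hd : 0 < d) (hd1 : d < 1) (hε : 0 < ε)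
    (hεd : ε ≤ d) :
    IsDirichletSolution unitDisk ((Metric.ball !₂[d, 0] ε).indicator fun _ => 4 * A / ε ^ 2)
      (diskPotential A d ε) where
  contDiffOn_closure := (contDiff_diskPotential A hd hd1 hε).contDiffOn
  eq_zero_on_boundary _ hx := diskPotential_eq_zero A hd hd1 hε hεd hx
  locallyIntegrableOn_rhs := by
    refine LocallyIntegrable.locallyIntegrableOn (Integrable.locallyIntegrable ?_) _
    rw [integrable_indicator_iff measurableSet_ball]
    exact integrableOn_const measure_ball_lt_top.ne
  weak_eq _ hφ hc hs := weak_eq_diskPotential A hd hd1 hε hφ hc hs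

/-! ### Pointwise bounds on the potential -/

lemma log_max_sub_one_le_cappedLog {s t : ℝ} (hs : 0 < s) (ht : 0 ≤ t) :
    Real.log (max t s) - 1 ≤ cappedLog s t := by
  have : 0 ≤ min (t / s) 1 := le_min (div_nonneg ht hs.le) zero_le_one
  rw [cappedLog]
  linarith

lemma diskPotential_center (A : ℝ) {d ε : ℝ} (hd : 0 < d) (hd1 : d < 1) (hε : 0 < ε) :
    diskPotential A d ε !₂[d, 0] = A * (2 * Real.log ((2 - d) * d / ε) + 1) := by
  have hmem : (!₂[d, 0] : Plane) ∈ closure unitDisk := by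
    rw [mem_closure_unitDisk_iff]
    simp
    rw [abs_le]
    constructor <;> linarith
  have h2 : 0 < (2 - d) * d := mul_pos (by linarith) hd
  rw [diskPotential_eq A hd hd1 ε hmem, ballPotential, sub_self, norm_zero,
    cappedLog_of_ge (pow_pos hε 2) (by simp [sq_nonneg]), Real.log_div h2.ne' hε.ne', Real.log_pow]
  have : ((1 - d) * (!₂[d, 0] : Plane) 0 + d) ^ 2 + ((1 - d) * (!₂[d, 0] : Plane) 1) ^ 2 =
      ((2 - d) * d) ^ 2 := by
    simp
    ring
  rw [this, Real.log_pow]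
  push_cast
  ring

/-- On the small ball the capped logarithm is at most `log ε²`, while `x 0 > 0` gives `‖(1-d)x + a‖
≥ d`. -/
lemma exp_neg_diskPotential_le {A d ε : ℝ} (hA : 0 ≤ A) (hd : 0 < d) (hd1 : d < 1) (hε : 0 < ε)
    {x : Plane} (hx : x ∈ unitDisk) (hxb : x ∈ Metric.ball !₂[d, 0] ε) :
    Real.exp (-diskPotential A d ε x) ≤ (ε / d) ^ (2 * A) := by
  have hr : ‖x - !₂[d, 0]‖ ^ 2 ≤ ε ^ 2 :=
    pow_le_pow_left₀ (norm_nonneg _) (mem_ball_iff_norm.mp hxb).le 2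
  have hx0 : 0 < x 0 := by
    have := mem_unitDisk_iff.mp hx
    nlinarith [sq_nonneg (x 0), sq_nonneg (x 1)]
  have hH : d ^ 2 ≤ ((1 - d) * x 0 + d) ^ 2 + ((1 - d) * x 1) ^ 2 := by
    have : 0 ≤ (1 - d) * x 0 := mul_nonneg (by linarith) hx0.le
    nlinarith [sq_nonneg ((1 - d) * x 0), sq_nonneg ((1 - d) * x 1), mul_nonneg this hd.le]
  have hlog := Real.log_le_log (pow_pos hd 2) hH
  rw [Real.log_pow] at hlog
  rw [diskPotential_eq A hd hd1 ε (subset_closure hx), ballPotential,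
    cappedLog_of_ge (pow_pos hε 2) hr, Real.rpow_def_of_pos (div_pos hε hd),
    Real.log_div hε.ne' hd.ne', Real.exp_le_exp, Real.log_pow]
  have hq : ‖x - !₂[d, 0]‖ ^ 2 / ε ^ 2 ≤ 1 := by
    rwa [div_le_one (pow_pos hε 2)]
  push_cast at hlog ⊢
  nlinarith

/-- The factor `e` pays for replacing the capped logarithm by `log (max r ε²)`, and the factor `2`
for replacing the maximum by the sum. -/
lemma exp_diskPotential_le {A d ε : ℝ} (hA : 0 ≤ A) (hd : 0 < d) (hd1 : d < 1) (hε : 0 < ε)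
    {x : Plane} (hx : x ∈ unitDisk) :
    Real.exp (diskPotential A d ε x) ≤
      (2 * Real.exp 1 * (2 * ‖x - !₂[d, 0]‖ ^ 2 + 8 * d ^ 2) /
        (‖x - !₂[d, 0]‖ ^ 2 + ε ^ 2)) ^ A := by
  set r := ‖x - !₂[d, 0]‖ ^ 2 with hr
  have hr0 : 0 ≤ r := sq_nonneg _
  have hx0 : 0 < x 0 := by
    have := mem_unitDisk_iff.mp hx
    nlinarith [sq_nonneg (x 0), sq_nonneg (x 1)]
  set H := ((1 - d) * x 0 + d) ^ 2 + ((1 - d) * x 1) ^ 2 with hH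
  have hHpos : 0 < H := by
    have : 0 < (1 - d) * x 0 + d := add_pos (mul_pos (by linarith) hx0) hd
    positivity
  have hHle : H ≤ 2 * r + 8 * d ^ 2 := by
    rw [hr, norm_sub_center_sq, hH]
    -- Decompose `(1-d) x 0 + d = (1-d)(x 0 - d) + (2-d) d`.
    have h1 : ((1 - d) * x 0 + d) ^ 2 ≤ 2 * ((1 - d) * (x 0 - d)) ^ 2 + 2 * ((2 - d) * d) ^ 2 := by
      nlinarith [sq_nonneg ((1 - d) * (x 0 - d) - (2 - d) * d)]
    have hd2 : (1 - d) ^ 2 ≤ 1 := by nlinarith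
    have hd3 : (2 - d) ^ 2 ≤ 4 := by nlinarith
    nlinarith [mul_le_mul_of_nonneg_right hd2 (sq_nonneg (x 0 - d)),
      mul_le_mul_of_nonneg_right hd2 (sq_nonneg (x 1)),
      mul_le_mul_of_nonneg_right hd3 (sq_nonneg d)]
  set M := max r (ε ^ 2) with hM
  have hMpos : 0 < M := lt_max_of_lt_right (pow_pos hε 2)
  have hM2 : r + ε ^ 2 ≤ 2 * M := by
    have := le_max_left r (ε ^ 2)
    have := le_max_right r (ε ^ 2)
    linarith
  have hre : 0 < r + ε ^ 2 := by positivity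
  calc Real.exp (diskPotential A d ε x)
      ≤ Real.exp (Real.log (Real.exp 1 * H / M) * A) := by
        rw [Real.exp_le_exp, diskPotential_eq A hd hd1 ε (subset_closure hx), mul_comm,
          Real.log_div (by positivity) hMpos.ne', Real.log_mul (by positivity) hHpos.ne',
          Real.log_exp]
        have := log_max_sub_one_le_cappedLog (pow_pos hε 2) hr0
        refine mul_le_mul_of_nonneg_right ?_ hA
        rw [ballPotential]
        linarith
    _ = (Real.exp 1 * H / M) ^ A := (Real.rpow_def_of_pos (by positivity) A).symm
    _ ≤ _ := by
        refine Real.rpow_le_rpow (by positivity) ?_ hA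
        rw [div_le_div_iff₀ hMpos hre]
        have e := Real.exp_pos 1
        calc Real.exp 1 * H * (r + ε ^ 2) ≤ Real.exp 1 * (2 * r + 8 * d ^ 2) * (2 * M) := by gcongr
          _ = _ := by ring

/-! ### Integral bounds -/

lemma integrableOn_norm_rpow_unitDisk {α : ℝ} (hα : α < 1) :
    IntegrableOn (fun x : Plane => ‖x‖ ^ (-(2 * α))) unitDisk := by
  have h : IntegrableOn (fun x : Plane => ‖x‖ ^ (-(2 * α))) (Metric.ball 0 2) := by
    rw [integrableOn_fun_norm_addHaar volume (f := fun y => y ^ (-(2 * α)))]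
    have h1 : IntegrableOn (fun y : ℝ => y ^ (1 - 2 * α)) (Ioo 0 2) := by
      rw [← intervalIntegrable_iff_integrableOn_Ioo_of_le zero_le_two]
      exact intervalIntegral.intervalIntegrable_rpow' (by linarith)
    refine h1.congr_fun (fun y hy => ?_) measurableSet_Ioo
    simp [sub_eq_add_neg, Real.rpow_add hy.1]
  refine h.mono_set (Metric.ball_subset_ball' ?_)
  rw [EuclideanSpace.dist_eq]
  simp
  norm_num

lemma rpow_neg_norm_sub_sq_add_sq {A ε : ℝ} (hε : 0 < ε) (c x : Plane) :
    (‖x - c‖ ^ 2 + ε ^ 2) ^ (-A) =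
      ε ^ (-(2 * A)) * (1 + ‖ε⁻¹ • (x - c)‖ ^ 2) ^ (-A) := by
  have h : ‖x - c‖ ^ 2 + ε ^ 2 = ε ^ 2 * (1 + ‖ε⁻¹ • (x - c)‖ ^ 2) := by
    rw [norm_smul, norm_inv, Real.norm_of_nonneg hε.le]
    field_simp
    ring
  rw [h, Real.mul_rpow (by positivity) (by positivity), ← Real.rpow_natCast ε 2,
    ← Real.rpow_mul hε.le]
  congr 2
  push_cast
  ring

lemma integrable_rpow_neg_one_add_norm_sq_plane {A : ℝ} (hA : 1 < A) :
    Integrable fun x : Plane => (1 + ‖x‖ ^ 2) ^ (-A) := by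
  have h := integrable_rpow_neg_one_add_norm_sq (E := Plane) (μ := volume) (r := 2 * A)
    (by simp; linarith)
  simpa [neg_div] using h

lemma integrable_rpow_neg_norm_sub_sq_add_sq {A ε : ℝ} (hA : 1 < A) (hε : 0 < ε) (c : Plane) :
    Integrable fun x : Plane => (‖x - c‖ ^ 2 + ε ^ 2) ^ (-A) := by
  simp_rw [rpow_neg_norm_sub_sq_add_sq hε c]
  have h := (integrable_rpow_neg_one_add_norm_sq_plane hA).comp_smul (inv_ne_zero hε.ne')
  exact (h.comp_sub_right c).const_mul _

lemma integral_rpow_neg_norm_sub_sq_add_sq (A : ℝ) {ε : ℝ} (hε : 0 < ε) (c : Plane) :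
    ∫ x : Plane, (‖x - c‖ ^ 2 + ε ^ 2) ^ (-A) =
      ε ^ (2 - 2 * A) * ∫ x : Plane, (1 + ‖x‖ ^ 2) ^ (-A) := by
  simp_rw [rpow_neg_norm_sub_sq_add_sq hε c]
  rw [integral_const_mul,
    integral_sub_right_eq_self (fun x : Plane => (1 + ‖ε⁻¹ • x‖ ^ 2) ^ (-A)) c,
    Measure.integral_comp_inv_smul_of_nonneg volume (fun x : Plane => (1 + ‖x‖ ^ 2) ^ (-A)) hε.le,
    smul_eq_mul, ← mul_assoc, sub_eq_add_neg, Real.rpow_add hε]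
  simp [mul_comm]

lemma exp_diskPotential_div_le {α A d ε : ℝ} (hα : 0 < α) (hA : 1 < A) (hd : 0 < d) (hd1 : d < 1)
    (hε : 0 < ε) {x : Plane} (hx : x ∈ unitDisk) :
    Real.exp (diskPotential A d ε x) / ‖x‖ ^ (2 * α) ≤
      (68 * Real.exp 1) ^ A * ‖x‖ ^ (-(2 * α)) +
      (18 * Real.exp 1) ^ A * 4 ^ α * d ^ (2 * (A - α)) *
        (‖x - !₂[d, 0]‖ ^ 2 + ε ^ 2) ^ (-A) := by
  have hA0 : 0 ≤ A := by linarith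
  have hexp := exp_diskPotential_le hA0 hd hd1 hε hx
  set r := ‖x - !₂[d, 0]‖ ^ 2 with hr
  have hr0 : 0 ≤ r := sq_nonneg _
  have he := Real.exp_pos 1
  have hre : 0 < r + ε ^ 2 := by positivity
  rw [div_eq_mul_inv, ← Real.rpow_neg (norm_nonneg _)]
  have hN : 0 ≤ ‖x‖ ^ (-(2 * α)) := by positivity
  -- Far from the centre `d² ≤ 4r`, so `2(2r + 8d²) ≤ 68r`. Near it `r < d²/4`, so the same quantity
  -- is below `18d²`, and `x 0 ≥ d/2` controls the singular weight.
  rcases le_or_gt (d ^ 2 / 4) r with h | h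
  · refine le_add_of_le_of_nonneg (mul_le_mul_of_nonneg_right (hexp.trans ?_) hN) (by positivity)
    refine Real.rpow_le_rpow (by positivity) ?_ hA0
    rw [div_le_iff₀ hre]
    have : 2 * (2 * r + 8 * d ^ 2) ≤ 68 * (r + ε ^ 2) := by nlinarith [sq_nonneg ε]
    nlinarith
  · refine le_add_of_nonneg_of_le (by positivity) ?_
    have hE : Real.exp (diskPotential A d ε x) ≤
        (18 * Real.exp 1) ^ A * d ^ (2 * A) * (r + ε ^ 2) ^ (-A) := by
      have e1 : (18 * Real.exp 1) ^ A * d ^ (2 * A) * (r + ε ^ 2) ^ (-A) =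
          (18 * Real.exp 1 * d ^ 2 / (r + ε ^ 2)) ^ A := by
        rw [Real.div_rpow (by positivity) hre.le,
          Real.mul_rpow (x := 18 * Real.exp 1) (by positivity) (by positivity), Real.rpow_neg hre.le, ← Real.rpow_natCast d 2, ← Real.rpow_mul hd.le, div_eq_mul_inv]
        push_cast
        rfl
      rw [e1]
      refine hexp.trans (Real.rpow_le_rpow (by positivity) ?_ hA0)
      gcongr ?_ / _
      nlinarith
    have hxd : d ^ 2 / 4 ≤ ‖x‖ ^ 2 := by
      have hn : ‖x‖ ^ 2 = (x 0) ^ 2 + (x 1) ^ 2 := by simp [EuclideanSpace.norm_sq_eq]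
      rw [hr, norm_sub_center_sq] at h
      have h0 : d / 2 ≤ x 0 := by nlinarith [sq_nonneg (x 1)]
      nlinarith [sq_nonneg (x 1)]
    have hX : ‖x‖ ^ (-(2 * α)) ≤ 4 ^ α * d ^ (-(2 * α)) := by
      have e2 : ‖x‖ ^ (-(2 * α)) = (‖x‖ ^ 2) ^ (-α) := by
        rw [← Real.rpow_natCast ‖x‖ 2, ← Real.rpow_mul (norm_nonneg _)]
        norm_num
      have e3 : 4 ^ α * d ^ (-(2 * α)) = (d ^ 2 / 4) ^ (-α) := by
        rw [Real.div_rpow (by positivity) (by norm_num), ← Real.rpow_natCast d 2,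
          ← Real.rpow_mul hd.le, Real.rpow_neg (by norm_num : (0 : ℝ) ≤ 4)]
        norm_num [mul_comm]
      rw [e2, e3]
      exact Real.rpow_le_rpow_of_nonpos (by positivity) hxd (by linarith)
    calc _ ≤ ((18 * Real.exp 1) ^ A * d ^ (2 * A) * (r + ε ^ 2) ^ (-A)) *
          (4 ^ α * d ^ (-(2 * α))) := by gcongr
      _ = _ := by
        rw [show 2 * (A - α) = 2 * A + -(2 * α) by ring, Real.rpow_add hd]
        ring

lemma integrableOn_and_integral_exp_diskPotential_div_le {α A d ε : ℝ} (hα : α ∈ Ioo (0 : ℝ) 1)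
    (hA : 1 < A) (hd : 0 < d) (hd1 : d < 1) (hε : 0 < ε) :
    IntegrableOn (fun x => Real.exp (diskPotential A d ε x) / ‖x‖ ^ (2 * α)) unitDisk ∧
    ∫ x in unitDisk, Real.exp (diskPotential A d ε x) / ‖x‖ ^ (2 * α) ≤
      (68 * Real.exp 1) ^ A * (∫ x in unitDisk, ‖x‖ ^ (-(2 * α))) +
      (18 * Real.exp 1) ^ A * 4 ^ α * d ^ (2 * (A - α)) *
        (ε ^ (2 - 2 * A) * ∫ x : Plane, (1 + ‖x‖ ^ 2) ^ (-A)) := by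
  have hm : MeasurableSet unitDisk := measurableSet_ball
  have hle (x : Plane) (hx : x ∈ unitDisk) := exp_diskPotential_div_le hα.1 hA hd hd1 hε hx
  have i1 := (integrableOn_norm_rpow_unitDisk hα.2).const_mul ((68 * Real.exp 1) ^ A)
  have i2 := (integrable_rpow_neg_norm_sub_sq_add_sq hA hε !₂[d, 0]).const_mul
    ((18 * Real.exp 1) ^ A * 4 ^ α * d ^ (2 * (A - α)))
  have hi := i1.add i2.integrableOn
  have hu := (contDiff_diskPotential A hd hd1 hε).continuous.measurable
  have hint : IntegrableOn (fun x => Real.exp (diskPotential A d ε x) / ‖x‖ ^ (2 * α))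
      unitDisk := by
    refine Integrable.mono' hi (Measurable.aestronglyMeasurable (by fun_prop)) ?_
    filter_upwards [ae_restrict_mem hm] with x hx
    rw [Real.norm_of_nonneg (by positivity)]
    exact hle x hx
  refine ⟨hint, (setIntegral_mono_on hint hi hm hle).trans ?_⟩
  simp only [Pi.add_apply]
  rw [integral_add i1 i2.integrableOn, integral_const_mul,
    ← integral_rpow_neg_norm_sub_sq_add_sq A hε !₂[d, 0]]
  refine add_le_add_right ?_ _
  rw [← integral_const_mul]
  exact setIntegral_le_integral i2 (.of_forall fun x => by positivity)

/-! ### Choice of the concentration distance -/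

section Concentration

variable {α A ε : ℝ}

/-- This balance determines `β`; it serves both the bound on `V` and the integral bound. -/
lemma concDist_rpow (hα : α < 1) (hA : 1 < A) (hε : 0 < ε) :
    concDist α A ε ^ (2 * (A - α)) = ε ^ (2 * A - 2) := by
  rw [concDist, ← Real.rpow_mul hε.le]
  congr 1
  have : A - α ≠ 0 := by linarith
  field_simp

lemma concDist_mem (hα : α < 1) (hA : 1 < A) (hε : ε ∈ Ioo (0 : ℝ) 1) :
    ε < concDist α A ε ∧ concDist α A ε < 1 := by
  have h : 0 < A - α := by linarith
  refine ⟨?_, Real.rpow_lt_one hε.1.le hε.2 (div_pos (by linarith) h)⟩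
  conv_lhs => rw [← Real.rpow_one ε]
  refine Real.rpow_lt_rpow_of_exponent_gt hε.1 hε.2 ?_
  rw [div_lt_one h]
  linarith

/-- As `2 - d ≥ 1`, the value at the centre is at least `2A log (d/ε) = 2A (β - 1) log ε`, and `β <
1`. -/
lemma tendsto_diskPotential_center (hα : α < 1) (hA : 1 < A) :
    Tendsto (fun ε => diskPotential A (concDist α A ε) ε (concPoint α A ε)) (𝓝[>] 0) atTop := by
  have hβ : (A - 1) / (A - α) - 1 < 0 := by
    rw [sub_neg, div_lt_one (by linarith)]
    linarith
  have h1 : Tendsto (fun ε : ℝ => A * (2 * (((A - 1) / (A - α) - 1) * Real.log ε)))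
      (𝓝[>] 0) atTop :=
    ((Real.tendsto_log_nhdsGT_zero.const_mul_atBot_of_neg hβ).const_mul_atTop
      zero_lt_two).const_mul_atTop (by linarith)
  refine tendsto_atTop_mono' _ ?_ h1
  filter_upwards [Ioo_mem_nhdsGT zero_lt_one] with ε hε
  obtain ⟨hεd, hd1⟩ := concDist_mem hα hA hε
  have hd := hε.1.trans hεd
  rw [concPoint, diskPotential_center A hd hd1 hε.1]
  have hlog : ((A - 1) / (A - α) - 1) * Real.log ε = Real.log (concDist α A ε / ε) := by
    rw [Real.log_div hd.ne' hε.1.ne', concDist, Real.log_rpow hε.1]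
    ring
  have hmono : Real.log (concDist α A ε / ε) ≤
      Real.log ((2 - concDist α A ε) * concDist α A ε / ε) := by
    refine Real.log_le_log (div_pos hd hε.1) ?_
    have := hε.1
    gcongr
    nlinarith
  rw [hlog]
  refine mul_le_mul_of_nonneg_left ?_ (by linarith)
  linarith

lemma tendsto_sSup_diskPotential (hα : α < 1) (hA : 1 < A) :
    Tendsto (fun ε => sSup (diskPotential A (concDist α A ε) ε '' unitDisk)) (𝓝[>] 0) atTop := by
  refine tendsto_atTop_mono' _ ?_ (tendsto_diskPotential_center hα hA)
  filter_upwards [Ioo_mem_nhdsGT zero_lt_one] with ε hε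
  obtain ⟨hεd, hd1⟩ := concDist_mem hα hA hε
  have hd := hε.1.trans hεd
  refine le_csSup ?_ (mem_image_of_mem _ ?_)
  · have hK : IsCompact (closure unitDisk) := Metric.isBounded_ball.isCompact_closure
    exact (hK.bddAbove_image (contDiff_diskPotential A hd hd1 hε.1).continuous.continuousOn).mono
      (image_mono subset_closure)
  · exact ball_subset_unitDisk hd1 hεd.le (Metric.mem_ball_self hε.1)

lemma weight_le (hα : α ∈ Ioo (0 : ℝ) 1) (hA : 1 < A) (hε : ε ∈ Ioo (0 : ℝ) 1) {x : Plane}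
    (hx : x ∈ unitDisk) :
    ‖x‖ ^ (2 * α) * brezisMerleRhs α A ε x *
      Real.exp (-diskPotential A (concDist α A ε) ε x) ≤ 4 ^ α * (4 * A) := by
  obtain ⟨hεd, hd1⟩ := concDist_mem hα.2 hA hε
  have hε0 := hε.1
  have hd := hε0.trans hεd
  have hA0 : 0 ≤ A := by linarith
  have hα0 := hα.1
  have hpow := concDist_rpow hα.2 hA hε0
  by_cases hxb : x ∈ Metric.ball (concPoint α A ε) ε
  · have hexp := exp_neg_diskPotential_le hA0 hd hd1 hε0 hx hxb
    rw [brezisMerleRhs, indicator_of_mem hxb]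
    rw [concPoint] at hxb
    set d := concDist α A ε
    have hxn : ‖x‖ ≤ 2 * d := by
      have h1 : ‖(!₂[d, 0] : Plane)‖ = d := by
        rw [EuclideanSpace.norm_eq]
        simp [Real.sqrt_sq hd.le]
      have h2 := norm_le_norm_add_norm_sub' x !₂[d, 0]
      have h3 := mem_ball_iff_norm.mp hxb
      linarith
    calc ‖x‖ ^ (2 * α) * (4 * A / ε ^ 2) * Real.exp (-diskPotential A d ε x)
        ≤ (2 * d) ^ (2 * α) * (4 * A / ε ^ 2) * (ε / d) ^ (2 * A) := by gcongr
      _ = 2 ^ (2 * α) * (4 * A) * (ε ^ (2 * A) / ε ^ 2 / (d ^ (2 * A) / d ^ (2 * α))) := by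
        rw [Real.mul_rpow zero_le_two hd.le, Real.div_rpow hε0.le hd.le]
        field_simp
      _ = 2 ^ (2 * α) * (4 * A) * (ε ^ (2 * A - 2) / d ^ (2 * (A - α))) := by
        rw [mul_sub, Real.rpow_sub hd, Real.rpow_sub hε0, Real.rpow_two]
      _ = 4 ^ α * (4 * A) := by
        rw [hpow, div_self (by positivity), mul_one, Real.rpow_mul zero_le_two, Real.rpow_two]
        norm_num
  · rw [brezisMerleRhs, indicator_of_notMem hxb]
    simp only [mul_zero, zero_mul]
    positivity

end Concentration

theorem mainTheorem1 (α A : ℝ) (hα : α ∈ Ioo (0 : ℝ) 1) (hA : 1 < A) :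
    ∃ u V : ℝ → Plane → ℝ,
      (∀ ε ∈ Ioo (0 : ℝ) 1,
        IsDirichletSolution unitDisk (brezisMerleRhs α A ε) (u ε) ∧
        (∀ x, V ε x = ‖x‖ ^ (2 * α) * brezisMerleRhs α A ε x * Real.exp (-u ε x)) ∧
        IsDirichletSolution unitDisk
          (fun x => V ε x * (Real.exp (u ε x) / ‖x‖ ^ (2 * α))) (u ε)) ∧
      (∃ C : ℝ, ∀ ε ∈ Ioo (0 : ℝ) 1,
        (∀ x ∈ unitDisk, 0 ≤ V ε x ∧ V ε x ≤ C) ∧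
        IntegrableOn (fun x => Real.exp (u ε x) / ‖x‖ ^ (2 * α)) unitDisk ∧
        ∫ x in unitDisk, Real.exp (u ε x) / ‖x‖ ^ (2 * α) ≤ C) ∧
      Tendsto (fun ε => sSup (u ε '' unitDisk)) (𝓝[>] 0) atTop := by
  have hA0 : 0 ≤ A := by linarith
  have hα0 := hα.1
  refine ⟨fun ε => diskPotential A (concDist α A ε) ε, fun ε x => ‖x‖ ^ (2 * α) *
    brezisMerleRhs α A ε x * Real.exp (-diskPotential A (concDist α A ε) ε x),
    fun ε hε => ?_, ?_, tendsto_sSup_diskPotential hα.2 hA⟩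
  · obtain ⟨hεd, hd1⟩ := concDist_mem hα.2 hA hε
    have hd := hε.1.trans hεd
    have hsol : IsDirichletSolution unitDisk (brezisMerleRhs α A ε)
        (diskPotential A (concDist α A ε) ε) :=
      isDirichletSolution_diskPotential A hd hd1 hε.1 hεd.le
    refine ⟨hsol, fun x => rfl, ?_⟩
    convert hsol using 1
    funext x
    -- At the origin `‖x‖ ^ (2 * α)` is `0` and cannot be cancelled. There `f_ε` vanishes, because
    -- `B_ε(a_ε)` lies in the open disk, so both sides are `0`.
    by_cases hx : x = 0
    · have h0 : (0 : Plane) ∉ Metric.ball (concPoint α A ε) ε := fun h => by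
        have := mem_unitDisk_iff.mp (ball_subset_unitDisk hd1 hεd.le h)
        simp at this
      have hf : brezisMerleRhs α A ε 0 = 0 := indicator_of_notMem h0 _
      simp [hx, hf]
    · have : ‖x‖ ^ (2 * α) ≠ 0 := (Real.rpow_pos_of_pos (norm_pos_iff.mpr hx) _).ne'
      beta_reduce
      rw [Real.exp_neg]
      field_simp
  · set K₁ := (68 * Real.exp 1) ^ A * ∫ x in unitDisk, ‖x‖ ^ (-(2 * α)) with hK₁
    set K₂ := (18 * Real.exp 1) ^ A * 4 ^ α * ∫ x : Plane, (1 + ‖x‖ ^ 2) ^ (-A) with hK₂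
    have hK₁0 : 0 ≤ K₁ := mul_nonneg (by positivity) (integral_nonneg fun x => by positivity)
    have hK₂0 : 0 ≤ K₂ := mul_nonneg (by positivity) (integral_nonneg fun x => by positivity)
    have hK₃0 : 0 ≤ (4 : ℝ) ^ α * (4 * A) := by positivity
    refine ⟨4 ^ α * (4 * A) + K₁ + K₂, fun ε hε => ?_⟩
    obtain ⟨hεd, hd1⟩ := concDist_mem hα.2 hA hε
    have hd := hε.1.trans hεd
    refine ⟨fun x hx => ⟨?_, (weight_le hα hA hε hx).trans (by linarith)⟩, ?_⟩
    · have : 0 ≤ brezisMerleRhs α A ε x := indicator_nonneg (fun _ _ => by positivity) x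
      positivity
    · obtain ⟨hint, hle⟩ :=
        integrableOn_and_integral_exp_diskPotential_div_le hα hA hd hd1 hε.1
      refine ⟨hint, hle.trans ?_⟩
      have hone : ε ^ (2 * A - 2) * ε ^ (2 - 2 * A) = 1 := by
        rw [← Real.rpow_add hε.1]
        simp
      rw [concDist_rpow hα.2 hA hε.1]
      have : (18 * Real.exp 1) ^ A * 4 ^ α * ε ^ (2 * A - 2) *
          (ε ^ (2 - 2 * A) * ∫ x : Plane, (1 + ‖x‖ ^ 2) ^ (-A)) = K₂ := by
        linear_combination K₂ * hone
      linarith
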